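/- Let $G=(V,E)$ be a finite directed graph on $n=|V|$ vertices and let $\pi : V \to [n]$ be a bijection (a vertex ordering). The \emph{lexicographically-first MIS} (LFMIS) of $G$ with respect to $\pi$ is the set $I$ produced by the following sequential process: start with $I=\emptyset$ and all vertices alive; process the vertices in increasing order of $\pi$; if the current vertex $v$ is alive, add $v$ to $I$ and mark all $u$ with $(v,u)\in E$ as dead. The \emph{parallel greedy algorithm} starts with $I=\emptyset$ and the residual vertex set $A=V$. While $A \neq \emptyset$ it executes a round: let $J$ be the set of all $v\in A$ such that there is no $u\in A$ with $(u,v)\in E$ and $\pi(u)<\pi(v)$; add $J$ to $I$; remove from $A$ the set $J$ and all vertices $u$ such that $(v,u)\in E$ and $\pi(v)<\pi(u)$ for some $v\in J$. For every $G$ and $\pi$ the parallel greedy algorithm terminates and its output $I$ is the LFMIS of $G$ with respect to $\pi$. Moreover, for every $c>0$ there is a constant $C>0$, depending only on $c$, such that for every directed graph $G$ with $n\ge 2$ vertices, if $\pi$ is a uniformly random vertex ordering, then: (i) with probability at least $1-n^{-c}$, the parallel greedy algorithm terminates within $C\log^2 n$ rounds; (ii) if $d\ge 1$ is an integer such that every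 in-degree of $G$ is at most $d$, and $x=d/\log n$, then with probability at least $1-n^{-c}$ the parallel greedy algorithm terminates within $$C\cdot\frac{\log(2+x)}{\log(2+1/x)}\cdot\log n$$ rounds, and with probability at least $1-n^{-c}$ it terminates within $C\log(d+1)\log n$ rounds. -/

import Mathlib

namespace DirectedLFMIS

/-- A vertex ordering of `V`: a bijection onto positions `0, …, n - 1`, where `n = |V|`. -/
abbrev Ordering (V : Type*) [Fintype V] : Type _ := V ≃ Fin (Fintype.card V)

/-- State of either algorithm: the vertices put into `I` so far, and the vertices that are still
alive (respectively, still present in the residual graph). -/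
@[ext] structure State (V : Type*) where
  chosen : Set V
  alive : Set V

/-- Both algorithms start with `I = ∅` and all vertices alive. -/
def State.initial (V : Type*) : State V := ⟨∅, Set.univ⟩

open Classical in
/-- One iteration of the sequential algorithm, processing the vertex `v`: if `v` is alive, add it
to `I` and mark all its out-neighbours as dead. -/
noncomputable def seqStep {V : Type*} (G : Digraph V) (s : State V) (v : V) : State V :=
  if v ∈ s.alive then ⟨insert v s.chosen, s.alive \ {u | G.Adj v u}⟩ else s

/-- The lexicographically-first MIS of the directed graph `G` with respect to `π`: the set `I`
produced by processing the vertices one by one in increasing order of `π`. -/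
noncomputable def lfmis {V : Type*} [Fintype V] (G : Digraph V) (π : Ordering V) : Set V :=
  ((List.ofFn π.symm).foldl (seqStep G) (State.initial V)).chosen

/-- The vertices `v` of the residual graph on `A` into which there is no residual edge `(u, v)`
with `u` before `v`. -/
def sources {V : Type*} [Fintype V] (G : Digraph V) (π : Ordering V) (A : Set V) : Set V :=
  {v | v ∈ A ∧ ¬ ∃ u ∈ A, G.Adj u v ∧ π u < π v}

/-- One round of the parallel greedy algorithm: add all sources to `I`, and remove from the
residual graph the sources together with all their later out-neighbours. -/
def greedyRound {V : Type*} [Fintype V] (G : Digraph V) (π : Ordering V) (s : State V) : State V :=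
  ⟨s.chosen ∪ sources G π s.alive,
    s.alive \ (sources G π s.alive ∪ {u | ∃ v ∈ sources G π s.alive, G.Adj v u ∧ π v < π u})⟩

/-- The state of the parallel greedy algorithm after `t` rounds. (Once the residual graph is empty,
further rounds change nothing.) -/
def greedyState {V : Type*} [Fintype V] (G : Digraph V) (π : Ordering V) (t : ℕ) : State V :=
  (greedyRound G π)^[t] (State.initial V)

/-- The parallel greedy algorithm terminates (its residual graph is empty) after at most `T`
rounds. -/
def TerminatesWithin {V : Type*} [Fintype V] (G : Digraph V) (π : Ordering V) (T : ℝ) : Prop :=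
  ∃ t : ℕ, (t : ℝ) ≤ T ∧ (greedyState G π t).alive = ∅

/-- The probability of the event `P` for a uniformly random vertex ordering. -/
noncomputable def orderProb (V : Type*) [Fintype V] (P : Ordering V → Prop) : ℝ :=
  ({π | P π} : Set (Ordering V)).ncard / Nat.card (Ordering V)

/-- Every in-degree of `G` is at most `d`. -/
def InDegreeLE {V : Type*} (G : Digraph V) (d : ℕ) : Prop :=
  ∀ v : V, ({u | G.Adj u v} : Set V).ncard ≤ d

end DirectedLFMIS

namespace DirectedLFMIS

open Classical in
/-- The probability that a uniformly random arrangement of `k` distinct elements of `S`, drawn one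
after the other, satisfies `Q`. -/
noncomputable def pr {V : Type*} : ℕ → Finset V → (List V → Prop) → ℝ
  | 0, _, Q => if Q [] then 1 else 0
  | k + 1, S, Q => (∑ u ∈ S, pr k (S.erase u) fun l => Q (u :: l)) / S.card

/-- `l` is an arrangement of `k` distinct elements of `S`. -/
structure IsArrangement {V : Type*} (S : Finset V) (k : ℕ) (l : List V) : Prop where
  nodup : l.Nodup
  length_eq : l.length = k
  mem : ∀ x ∈ l, x ∈ S

section Pr

open Classical

variable {V : Type*} {S : Finset V} {k : ℕ} {Q R : List V → Prop}

theorem IsArrangement.cons {u : V} {l : List V} (hu : u ∈ S)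
    (h : IsArrangement (S.erase u) k l) : IsArrangement S (k + 1) (u :: l) := by
  refine ⟨List.nodup_cons.2 ⟨fun hul => ?_, h.nodup⟩, by simp [h.length_eq], ?_⟩
  · exact absurd (h.mem u hul) (by simp)
  · intro x hx
    rcases List.mem_cons.1 hx with rfl | hx
    · exact hu
    · exact Finset.mem_of_mem_erase (h.mem x hx)

theorem IsArrangement.nil : IsArrangement S 0 [] := ⟨by simp, rfl, by simp⟩

theorem pr_nonneg (k : ℕ) (S : Finset V) (Q : List V → Prop) : 0 ≤ pr k S Q := by
  induction k generalizing S Q with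
  | zero => unfold pr; split_ifs <;> norm_num
  | succ k ih =>
    unfold pr
    exact div_nonneg (Finset.sum_nonneg fun u _ => ih _ _) (Nat.cast_nonneg _)

theorem pr_le_one (k : ℕ) (S : Finset V) (Q : List V → Prop) : pr k S Q ≤ 1 := by
  induction k generalizing S Q with
  | zero => unfold pr; split_ifs <;> norm_num
  | succ k ih =>
    unfold pr
    refine div_le_one_of_le₀ ?_ (Nat.cast_nonneg _)
    refine (Finset.sum_le_sum fun u _ => ih _ _).trans ?_
    simp

theorem pr_mono (h : ∀ l, IsArrangement S k l → Q l → R l) : pr k S Q ≤ pr k S R := by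
  induction k generalizing S Q R with
  | zero =>
    unfold pr
    have := h [] .nil
    split_ifs <;> simp_all
  | succ k ih =>
    unfold pr
    refine div_le_div_of_nonneg_right (Finset.sum_le_sum fun u hu => ih fun l hl => ?_)
      (Nat.cast_nonneg _)
    exact h _ (hl.cons hu)

theorem pr_false (k : ℕ) (S : Finset V) : pr k S (fun _ => False) = 0 := by
  induction k generalizing S with
  | zero => simp [pr]
  | succ k ih => simp [pr, ih]

theorem pr_eq_zero (h : ∀ l, IsArrangement S k l → ¬ Q l) : pr k S Q = 0 :=
  le_antisymm ((pr_mono h).trans_eq (pr_false k S)) (pr_nonneg _ _ _)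

theorem pr_or (k : ℕ) (S : Finset V) (Q R : List V → Prop) :
    pr k S (fun l => Q l ∨ R l) ≤ pr k S Q + pr k S R := by
  induction k generalizing S Q R with
  | zero => unfold pr; split_ifs <;> simp_all
  | succ k ih =>
    unfold pr
    rw [← add_div, ← Finset.sum_add_distrib]
    exact div_le_div_of_nonneg_right (Finset.sum_le_sum fun u _ => ih _ _ _) (Nat.cast_nonneg _)

theorem pr_exists {ι : Type*} (F : Finset ι) (Q : ι → List V → Prop) :
    pr k S (fun l => ∃ i ∈ F, Q i l) ≤ ∑ i ∈ F, pr k S (Q i) := by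
  induction F using Finset.induction_on with
  | empty => simp [pr_false]
  | insert a F ha ih =>
    rw [Finset.sum_insert ha]
    calc _ ≤ pr k S (fun l => Q a l ∨ ∃ i ∈ F, Q i l) := pr_mono fun l _ => by simp
      _ ≤ _ := (pr_or _ _ _ _).trans (by gcongr)

/-- Conditioning on the first `a` draws. -/
theorem pr_add_le {a b : ℕ} {q : ℝ} (hq : 0 ≤ q)
    (h : ∀ l, IsArrangement S a l → ¬ R l →
      pr b (S \ l.toFinset) (fun l' => Q (l ++ l')) ≤ q) :
    pr (a + b) S Q ≤ pr a S R + q := by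
  induction a generalizing S Q R with
  | zero =>
    by_cases hR : R []
    · have : pr 0 S R = 1 := by simp [pr, hR]
      rw [this]
      linarith [pr_le_one (0 + b) S Q]
    · have := h [] .nil hR
      simp only [List.toFinset_nil, Finset.sdiff_empty, List.nil_append] at this
      rw [zero_add]
      linarith [pr_nonneg 0 S R]
  | succ a ih =>
    rw [Nat.add_right_comm]
    unfold pr
    have herase (u : V) (l : List V) : S \ insert u l.toFinset = S.erase u \ l.toFinset := by
      ext; simp; tauto
    have key : ∀ u ∈ S, pr (a + b) (S.erase u) (fun l => Q (u :: l)) ≤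
        pr a (S.erase u) (fun l => R (u :: l)) + q := by
      intro u hu
      refine ih fun l hl hR => ?_
      have := h _ (hl.cons hu) hR
      rwa [List.toFinset_cons, herase] at this
    refine (div_le_div_of_nonneg_right (Finset.sum_le_sum key) (Nat.cast_nonneg _)).trans ?_
    rw [Finset.sum_add_distrib, add_div, Finset.sum_const, nsmul_eq_mul]
    gcongr
    rw [mul_div_right_comm]
    exact mul_le_of_le_one_left hq (div_self_le_one _)

theorem pr_take_le {a b : ℕ} : pr (a + b) S (fun l => Q (l.take a)) ≤ pr a S Q := by
  refine (pr_add_le (R := Q) le_rfl fun l hl hQ => ?_).trans_eq (add_zero _)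
  refine (pr_eq_zero fun l' _ => ?_).le
  rwa [List.take_left' hl.length_eq]

theorem card_le_factorial_mul_pr (hk : S.card = k) (F : Finset (List V))
    (hF : ∀ l ∈ F, IsArrangement S k l ∧ Q l) : (F.card : ℝ) ≤ k.factorial * pr k S Q := by
  induction k generalizing S Q F with
  | zero =>
    rcases F.eq_empty_or_nonempty with rfl | ⟨l, hl⟩
    · simpa using pr_nonneg 0 S Q
    · have h1 : F ⊆ {[]} := fun l hl => by
        simpa using (hF l hl).1.length_eq
      have h2 : Q [] := by
        have := hF l hl
        rwa [List.length_eq_zero_iff.1 this.1.length_eq, and_iff_right .nil] at this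
      have := Finset.card_le_card h1
      simp only [Finset.card_singleton] at this
      simpa [pr, h2] using this
  | succ k ih =>
    let E : V → Finset (List V) := fun u => (F.filter fun l => l.head? = some u).image List.tail
    have hE : ∀ u l, l ∈ E u → u :: l ∈ F := by
      intro u l hl
      obtain ⟨l', hl', rfl⟩ := Finset.mem_image.1 hl
      obtain ⟨h1, h2⟩ := Finset.mem_filter.1 hl'
      rwa [List.cons_head?_tail h2]
    have hsub : F ⊆ S.biUnion fun u => (E u).image (List.cons u) := by
      intro l hl
      obtain ⟨ha, -⟩ := hF l hl
      cases l with
      | nil => exact absurd ha.length_eq (by simp)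
      | cons u l =>
        refine Finset.mem_biUnion.2 ⟨u, ha.mem u (by simp), Finset.mem_image_of_mem _ ?_⟩
        exact Finset.mem_image.2 ⟨u :: l, by simp [hl], rfl⟩
    have hcard : F.card ≤ ∑ u ∈ S, (E u).card :=
      (Finset.card_le_card hsub).trans (Finset.card_biUnion_le.trans
        (Finset.sum_le_sum fun u _ => Finset.card_image_le))
    have hle : ∀ u ∈ S, ((E u).card : ℝ) ≤
        k.factorial * pr k (S.erase u) (fun l => Q (u :: l)) := by
      intro u hu
      refine ih (by rw [Finset.card_erase_of_mem hu, hk]; rfl) _ fun l hl => ?_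
      obtain ⟨ha, hq⟩ := hF _ (hE u l hl)
      have hn := List.nodup_cons.1 ha.nodup
      refine ⟨⟨hn.2, by simpa using ha.length_eq, fun x hx => ?_⟩, hq⟩
      exact Finset.mem_erase.2 ⟨fun h => hn.1 (h ▸ hx), ha.mem x (by simp [hx])⟩
    calc (F.card : ℝ) ≤ ∑ u ∈ S, ((E u).card : ℝ) := by exact_mod_cast hcard
      _ ≤ ∑ u ∈ S, k.factorial * pr k (S.erase u) (fun l => Q (u :: l)) := Finset.sum_le_sum hle
      _ = (k + 1).factorial * pr (k + 1) S Q := by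
        rw [← Finset.mul_sum, pr, hk, Nat.factorial_succ]
        push_cast
        field_simp

theorem orderProb_le_pr [Fintype V] (Q : List V → Prop) :
    orderProb V (fun π => Q (List.ofFn π.symm)) ≤ pr (Fintype.card V) Finset.univ Q := by
  have hc : Nat.card (Ordering V) = (Fintype.card V).factorial := by
    rw [Nat.card_eq_fintype_card, Fintype.card_equiv (Fintype.equivFin V)]
  unfold orderProb
  rw [hc, div_le_iff₀' (by positivity)]
  set f : Ordering V → List V := fun π => List.ofFn π.symm with hf
  have hinj : Function.Injective f := fun π σ h => by
    have := List.ofFn_injective h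
    rw [← Equiv.symm_symm π, ← Equiv.symm_symm σ, Equiv.coe_fn_injective this]
  have := card_le_factorial_mul_pr (S := (Finset.univ : Finset V)) (Q := Q) Finset.card_univ
    ((Finset.univ.filter fun π : Ordering V => Q (f π)).image f) ?_
  · rw [Finset.card_image_of_injective _ hinj] at this
    rw [Set.ncard_eq_toFinset_card']
    simpa using this
  · intro l hl
    obtain ⟨π, hπ, rfl⟩ := Finset.mem_image.1 hl
    refine ⟨⟨List.nodup_ofFn.2 π.symm.injective, by simp [f], by simp⟩, (Finset.mem_filter.1 hπ).2⟩

theorem orderProb_not [Fintype V] (P : Ordering V → Prop) :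
    orderProb V P = 1 - orderProb V (fun π => ¬ P π) := by
  have hpos : (0 : ℝ) < Nat.card (Ordering V) := by
    rw [Nat.card_eq_fintype_card, Fintype.card_equiv (Fintype.equivFin V)]
    exact_mod_cast Nat.factorial_pos _
  have := Set.ncard_add_ncard_compl {π : Ordering V | P π}
  unfold orderProb
  rw [eq_sub_iff_add_eq, ← add_div, div_eq_one_iff_eq hpos.ne']
  exact_mod_cast this

theorem orderProb_mono [Fintype V] {P P' : Ordering V → Prop} (h : ∀ π, P π → P' π) :
    orderProb V P ≤ orderProb V P' := by
  unfold orderProb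
  gcongr with π
  · exact Set.toFinite _
  · exact h π

end Pr

section Residual

open Classical

variable {V : Type*} {G : Digraph V} {s : State V} {S : Finset V} {k m : ℕ}

theorem seqStep_alive_subset (G : Digraph V) (s : State V) (v : V) :
    (seqStep G s v).alive ⊆ s.alive := by
  unfold seqStep
  split_ifs
  · exact Set.sdiff_subset
  · exact subset_rfl

theorem foldl_seqStep_alive_subset (G : Digraph V) (s : State V) (l : List V) :
    (l.foldl (seqStep G) s).alive ⊆ s.alive := by
  induction l generalizing s with
  | nil => exact subset_rfl
  | cons u l ih => exact (ih _).trans (seqStep_alive_subset G s u)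

/-- The in-neighbours of `v` in `S` that are alive in the state `s`. -/
noncomputable def aliveInNeighbors (G : Digraph V) (s : State V) (S : Finset V) (v : V) :
    Finset V :=
  S.filter fun u => u ∈ s.alive ∧ G.Adj u v

theorem aliveInNeighbors_mono {s' : State V} {S' : Finset V} (h : s'.alive ⊆ s.alive)
    (hS : S' ⊆ S) (v : V) : aliveInNeighbors G s' S' v ⊆ aliveInNeighbors G s S v := by
  intro u hu
  obtain ⟨h1, h2, h3⟩ := Finset.mem_filter.1 hu
  exact Finset.mem_filter.2 ⟨hS h1, h h2, h3⟩

theorem pr_many_aliveInNeighbors_le {n : ℕ} {D : ℝ} (hD : 0 ≤ D) (hS : S.card ≤ n) (v : V) :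
    pr k S (fun l => v ∈ (l.foldl (seqStep G) s).alive ∧
      D ≤ (aliveInNeighbors G (l.foldl (seqStep G) s) (S \ l.toFinset) v).card) ≤
        Real.exp (-(D / n)) ^ k := by
  induction k generalizing s S with
  | zero => exact (pr_le_one _ _ _).trans_eq (pow_zero _).symm
  | succ k ih =>
    by_cases hK : D ≤ (aliveInNeighbors G s S v).card
    · set K := aliveInNeighbors G s S v with hKdef
      have hKS : K ⊆ S := Finset.filter_subset _ _
      have herase (u : V) (l : List V) : S \ insert u l.toFinset = S.erase u \ l.toFinset := by
        ext; simp; tauto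
      unfold pr
      simp only [List.foldl_cons, List.toFinset_cons, herase]
      rcases S.eq_empty_or_nonempty with rfl | hne
      · simpa using by positivity
      have hSpos : (0 : ℝ) < S.card := by exact_mod_cast hne.card_pos
      have hzero : ∀ u ∈ K, pr k (S.erase u) (fun l =>
          v ∈ (l.foldl (seqStep G) (seqStep G s u)).alive ∧
          D ≤ (aliveInNeighbors G (l.foldl (seqStep G) (seqStep G s u))
            (S.erase u \ l.toFinset) v).card) = 0 := by
        intro u hu
        obtain ⟨-, hu1, hu2⟩ := Finset.mem_filter.1 hu
        refine pr_eq_zero fun l _ h => ?_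
        have := foldl_seqStep_alive_subset _ _ _ h.1
        simp [seqStep, hu1, hu2] at this
      rw [← Finset.sum_sdiff hKS, Finset.sum_eq_zero hzero, add_zero, div_le_iff₀ hSpos]
      have hle := Finset.sum_le_sum fun u (_ : u ∈ S \ K) =>
        ih (s := seqStep G s u) ((Finset.card_le_card (Finset.erase_subset u S)).trans hS)
      refine hle.trans ?_
      rw [Finset.sum_const, nsmul_eq_mul, Finset.cast_card_sdiff hKS, pow_succ]
      have hSn : (S.card : ℝ) ≤ n := by exact_mod_cast hS
      have h1 : D ≤ D / n * n := (div_mul_cancel₀ D (hSpos.trans_le hSn).ne').ge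
      have h2 : D / n * S.card ≤ K.card := by
        refine le_trans ?_ hK
        rw [div_mul_eq_mul_div]
        exact div_le_of_le_mul₀ (Nat.cast_nonneg _) hD (by gcongr)
      have h3 := Real.add_one_le_exp (-(D / n))
      have h4 : ((S.card : ℝ) - K.card) ≤ Real.exp (-(D / n)) * S.card := by nlinarith
      calc _ ≤ (Real.exp (-(D / n)) * S.card) * Real.exp (-(D / n)) ^ k := by gcongr
        _ = _ := by ring
    · refine (pr_eq_zero fun l _ h => hK (h.2.trans ?_)).trans_le (by positivity)
      exact_mod_cast Finset.card_le_card (aliveInNeighbors_mono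
        (foldl_seqStep_alive_subset G s l) Finset.sdiff_subset v)

theorem pr_sublist_le (w : List V) (hw : w.Nodup) (hwS : ∀ x ∈ w, x ∈ S) :
    pr k S (fun l => w.Sublist l) ≤ (k.choose w.length : ℝ) / S.card.descFactorial w.length := by
  induction k generalizing S w with
  | zero =>
    cases w with
    | nil => simp [pr]
    | cons a w => simp [pr]
  | succ k ih =>
    cases w with
    | nil => simpa using pr_le_one _ _ _
    | cons a w =>
      obtain ⟨haw, hw'⟩ := List.nodup_cons.1 hw
      have haS : a ∈ S := hwS a (by simp)
      have hcard : S.card ≠ 0 := (Finset.card_pos.2 ⟨a, haS⟩).ne'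
      obtain ⟨N, hN⟩ := Nat.exists_eq_succ_of_ne_zero hcard
      have hT : (a :: w).toFinset ⊆ S := fun x hx => hwS x (by simpa using hx)
      have hTc : (a :: w).toFinset.card = w.length + 1 := by
        rw [List.toFinset_card_of_nodup hw, List.length_cons]
      have hmN : w.length ≤ N := by
        have := Finset.card_le_card hT
        omega
      have hzero : ∀ u ∈ w, pr k (S.erase u) (fun l => (a :: w).Sublist (u :: l)) = 0 := by
        intro u hu
        refine pr_eq_zero fun l hl h => ?_
        have hne : a ≠ u := fun h => haw (h ▸ hu)
        have h2 := (List.cons_sublist_cons'.1 h).resolve_right fun h => hne h.1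
        exact absurd (hl.mem u (h2.subset (by simp [hu]))) (by simp)
      have hfirst : pr k (S.erase a) (fun l => (a :: w).Sublist (a :: l)) ≤
          (k.choose w.length : ℝ) / N.descFactorial w.length := by
        have := ih (S := S.erase a) w hw' fun x hx => Finset.mem_erase.2
          ⟨fun h => haw (h ▸ hx), hwS x (by simp [hx])⟩
        rw [Finset.card_erase_of_mem haS, hN] at this
        simpa using this
      have hother : ∀ u ∈ S \ (a :: w).toFinset,
          pr k (S.erase u) (fun l => (a :: w).Sublist (u :: l)) ≤
            (k.choose (w.length + 1) : ℝ) / N.descFactorial (w.length + 1) := by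
        intro u hu
        obtain ⟨huS, hu⟩ := Finset.mem_sdiff.1 hu
        have hu' : u ∉ a :: w := by simpa using hu
        have := ih (S := S.erase u) (a :: w) hw fun x hx => Finset.mem_erase.2
          ⟨fun h => hu' (h ▸ hx), hwS x hx⟩
        rw [Finset.card_erase_of_mem huS, hN] at this
        refine le_trans (pr_mono fun l _ h => ?_) this
        exact (List.cons_sublist_cons'.1 h).resolve_right fun h => hu' (by simp [h.1])
      unfold pr
      rw [← Finset.sum_sdiff hT, List.toFinset_cons,
        Finset.sum_insert (by simpa using haw), Finset.sum_eq_zero (s := w.toFinset)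
          (fun u hu => hzero u (by simpa using hu)), add_zero, ← List.toFinset_cons, hN,
        div_le_iff₀ (by positivity)]
      refine (add_le_add (Finset.sum_le_sum hother) hfirst).trans ?_
      rw [Finset.sum_const, nsmul_eq_mul, Finset.card_sdiff_of_subset hT, hTc, hN,
        List.length_cons, Nat.succ_descFactorial_succ, Nat.choose_succ_succ,
        Nat.descFactorial_succ, Nat.succ_sub_succ]
      have hpos : (0 : ℝ) < N.descFactorial w.length := by
        exact_mod_cast Nat.descFactorial_pos.2 hmN
      rcases hmN.eq_or_lt with h | h
      · have hx : N - w.length = 0 := by omega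
        rw [hx]
        push_cast
        field_simp
        simp
      · have hx : (0 : ℝ) < (N - w.length : ℕ) := by exact_mod_cast Nat.sub_pos_of_lt h
        push_cast
        field_simp
        rw [add_comm]

/-- The walks with `m` steps inside `A`, each given by its first vertex and the list of the
others. -/
noncomputable def walks (G : Digraph V) (A : Finset V) : ℕ → Finset (V × List V)
  | 0 => A.image fun v => (v, [])
  | m + 1 => (walks G A m).biUnion fun p =>
      (A.filter fun u => G.Adj u p.1).image fun u => (u, p.1 :: p.2)

theorem card_walks_le {A : Finset V} {D : ℝ} (hD : 0 ≤ D)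
    (h : ∀ v ∈ A, ((A.filter fun u => G.Adj u v).card : ℝ) ≤ D) (m : ℕ) :
    (∀ p ∈ walks G A m, p.1 ∈ A) ∧ ((walks G A m).card : ℝ) ≤ A.card * D ^ m := by
  induction m with
  | zero =>
    refine ⟨fun p hp => ?_, ?_⟩
    · obtain ⟨v, hv, rfl⟩ := Finset.mem_image.1 hp
      exact hv
    · simpa [walks] using Finset.card_image_le
  | succ m ih =>
    refine ⟨fun p hp => ?_, ?_⟩
    · obtain ⟨q, -, hp⟩ := Finset.mem_biUnion.1 hp
      obtain ⟨u, hu, rfl⟩ := Finset.mem_image.1 hp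
      exact (Finset.mem_filter.1 hu).1
    · calc ((walks G A (m + 1)).card : ℝ)
          ≤ ∑ p ∈ walks G A m, ((A.filter fun u => G.Adj u p.1).card : ℝ) := by
            exact_mod_cast Finset.card_biUnion_le.trans
              (Finset.sum_le_sum fun p _ => Finset.card_image_le)
        _ ≤ ∑ p ∈ walks G A m, D := Finset.sum_le_sum fun p hp => h _ (ih.1 p hp)
        _ ≤ A.card * D ^ m * D := by
            rw [Finset.sum_const, nsmul_eq_mul]
            exact mul_le_mul_of_nonneg_right ih.2 hD
        _ = _ := by ring

theorem mem_walks {A : Finset V} (v : V) (w : List V) (hc : (v :: w).IsChain G.Adj)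
    (hA : ∀ x ∈ v :: w, x ∈ A) : (v, w) ∈ walks G A w.length := by
  induction w generalizing v with
  | nil => exact Finset.mem_image.2 ⟨v, hA v (by simp), rfl⟩
  | cons u w ih =>
    rw [List.isChain_cons_cons] at hc
    refine Finset.mem_biUnion.2 ⟨(u, w), ih u hc.2 fun x hx => hA x (by simp [hx]), ?_⟩
    exact Finset.mem_image.2 ⟨v, Finset.mem_filter.2 ⟨hA v (by simp), hc.1⟩, rfl⟩

/-- `l` contains, as a subsequence, a path of `G` through `m` vertices of `A`. -/
def HasPath (G : Digraph V) (A : Set V) (m : ℕ) (l : List V) : Prop :=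
  ∃ w : List V, w.length = m ∧ w.IsChain G.Adj ∧ (∀ x ∈ w, x ∈ A) ∧ w.Sublist l

theorem pr_hasPath_le {D : ℝ} (hD : 0 ≤ D)
    (h : ∀ v ∈ s.alive, ((aliveInNeighbors G s S v).card : ℝ) ≤ D) :
    pr k S (HasPath G s.alive (m + 1)) ≤
      S.card * D ^ m * ((k.choose (m + 1) : ℝ) / S.card.descFactorial (m + 1)) := by
  set A := S.filter (· ∈ s.alive) with hA
  have hAS : A ⊆ S := Finset.filter_subset _ _
  have hAD : ∀ v ∈ A, ((A.filter fun u => G.Adj u v).card : ℝ) ≤ D := by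
    intro v hv
    rw [hA, Finset.filter_filter]
    exact h v (Finset.mem_filter.1 hv).2
  set W := (walks G A m).filter fun p => (p.1 :: p.2).Nodup ∧ (p.1 :: p.2).length = m + 1 ∧
    ∀ x ∈ p.1 :: p.2, x ∈ A with hW
  have hWc : (W.card : ℝ) ≤ S.card * D ^ m :=
    calc (W.card : ℝ) ≤ (walks G A m).card := by
          exact_mod_cast Finset.card_le_card (Finset.filter_subset _ _)
      _ ≤ A.card * D ^ m := (card_walks_le hD hAD m).2
      _ ≤ _ := by gcongr
  calc _ ≤ pr k S (fun l => ∃ p ∈ W, (p.1 :: p.2).Sublist l) := by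
        refine pr_mono fun l hl => ?_
        rintro ⟨w, hw, hc, hwA, hwl⟩
        cases w with
        | nil => simp at hw
        | cons v w =>
          have hmem : ∀ x ∈ v :: w, x ∈ A := fun x hx =>
            Finset.mem_filter.2 ⟨hl.mem x (hwl.subset hx), hwA x hx⟩
          have hwm : w.length = m := by simpa using hw
          exact ⟨(v, w), Finset.mem_filter.2 ⟨hwm ▸ mem_walks v w hc hmem,
            hl.nodup.sublist hwl, hw, hmem⟩, hwl⟩
    _ ≤ ∑ p ∈ W, pr k S (fun l => (p.1 :: p.2).Sublist l) := pr_exists _ _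
    _ ≤ ∑ p ∈ W, ((k.choose (m + 1) : ℝ) / S.card.descFactorial (m + 1)) := by
        refine Finset.sum_le_sum fun p hp => ?_
        obtain ⟨-, h1, h2, h3⟩ := Finset.mem_filter.1 hp
        have := pr_sublist_le (k := k) (p.1 :: p.2) h1 fun x hx => hAS (h3 x hx)
        rwa [h2] at this
    _ ≤ _ := by
        rw [Finset.sum_const, nsmul_eq_mul]
        gcongr

theorem choose_div_descFactorial_le {N : ℕ} (hk : k ≤ N) (hm : m ≤ N) :
    (k.choose m : ℝ) / N.descFactorial m ≤ ((k : ℝ) / N) ^ m / m.factorial := by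
  have h : k.descFactorial m * N ^ m ≤ k ^ m * N.descFactorial m := by
    clear hm
    induction m with
    | zero => simp
    | succ m ih =>
      rw [Nat.descFactorial_succ, Nat.descFactorial_succ, pow_succ, pow_succ]
      have : (k - m) * N ≤ k * (N - m) := by
        rw [Nat.sub_mul, Nat.mul_sub]
        have := Nat.mul_le_mul_left m hk
        rw [mul_comm k m]
        omega
      calc (k - m) * k.descFactorial m * (N ^ m * N)
          = (k.descFactorial m * N ^ m) * ((k - m) * N) := by ring
        _ ≤ (k ^ m * N.descFactorial m) * (k * (N - m)) := Nat.mul_le_mul ih this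
        _ = _ := by ring
  have hN : (0 : ℝ) < N.descFactorial m := by exact_mod_cast Nat.descFactorial_pos.2 hm
  have hNm : (0 : ℝ) < (N : ℝ) ^ m := by
    rcases m.eq_zero_or_pos with rfl | h'
    · simp
    · have : 0 < N := h'.trans_le hm
      positivity
  rw [div_pow, div_div, div_le_div_iff₀ hN (by positivity)]
  rw [Nat.descFactorial_eq_factorial_mul_choose k m] at h
  have h' : (m.factorial * k.choose m * N ^ m : ℝ) ≤ k ^ m * N.descFactorial m := by
    exact_mod_cast h
  linarith

theorem pr_hasPath_le_pow {D : ℝ} (hD : 1 ≤ D) (hk : k ≤ S.card)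
    (h : ∀ v ∈ s.alive, ((aliveInNeighbors G s S v).card : ℝ) ≤ D) :
    pr k S (HasPath G s.alive (m + 1)) ≤
      S.card * ((D * k / S.card) ^ (m + 1) / (m + 1).factorial) := by
  have hD0 : 0 ≤ D := zero_le_one.trans hD
  rcases le_or_gt (m + 1) S.card with hm | hm
  · calc _ ≤ S.card * D ^ m * ((k.choose (m + 1) : ℝ) / S.card.descFactorial (m + 1)) :=
          pr_hasPath_le hD0 h
      _ ≤ S.card * D ^ (m + 1) * (((k : ℝ) / S.card) ^ (m + 1) / (m + 1).factorial) := by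
          refine mul_le_mul ?_ (choose_div_descFactorial_le hk hm) (by positivity) (by positivity)
          exact mul_le_mul_of_nonneg_left (pow_le_pow_right₀ hD m.le_succ) (Nat.cast_nonneg _)
      _ = _ := by rw [mul_div_assoc D, mul_pow]; ring
  · refine (pr_eq_zero fun l hl => ?_).trans_le (by positivity)
    rintro ⟨w, hw, -, -, hwl⟩
    have := hwl.length_le
    rw [hl.length_eq] at this
    omega

end Residual

section Chunk

open Classical

variable {V : Type*} [Fintype V]

/-- The positions `k, …, k + s - 1` of `l` contain a path through `m` vertices that are alive
after the first `k` vertices of `l` have been processed. -/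
def ChunkHasPath (G : Digraph V) (k s m : ℕ) (l : List V) : Prop :=
  HasPath G ((l.take k).foldl (seqStep G) (State.initial V)).alive m ((l.drop k).take s)

theorem pr_chunkHasPath_aux (G : Digraph V) {k s m : ℕ} {D : ℝ} (hD : 1 ≤ D)
    (hks : k + s ≤ Fintype.card V) :
    pr (Fintype.card V) Finset.univ (ChunkHasPath G k s (m + 1)) ≤
      pr k Finset.univ (fun l => ∃ v ∈ (l.foldl (seqStep G) (State.initial V)).alive,
        D < (aliveInNeighbors G (l.foldl (seqStep G) (State.initial V))
          (Finset.univ \ l.toFinset) v).card) +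
      Fintype.card V * ((D * s / (Fintype.card V - k)) ^ (m + 1) / (m + 1).factorial) := by
  obtain ⟨r, hr⟩ := Nat.exists_eq_add_of_le hks
  have hkn : (k : ℝ) ≤ Fintype.card V := by exact_mod_cast (Nat.le_add_right k s).trans hks
  have hD0 : 0 ≤ D := zero_le_one.trans hD
  have hq : 0 ≤ (D * s / (Fintype.card V - k)) ^ (m + 1) / ((m + 1).factorial : ℝ) := by
    have := sub_nonneg.2 hkn
    positivity
  have hlhs : pr (Fintype.card V) Finset.univ (ChunkHasPath G k s (m + 1)) =
      pr (k + (s + r)) Finset.univ (ChunkHasPath G k s (m + 1)) := by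
    rw [← add_assoc, ← hr]
  rw [hlhs]
  refine pr_add_le (by positivity) fun l hl hgood => ?_
  push Not at hgood
  have hlc : l.toFinset.card = k := by rw [List.toFinset_card_of_nodup hl.nodup, hl.length_eq]
  have hcard : (Finset.univ \ l.toFinset).card = Fintype.card V - k := by
    rw [Finset.card_sdiff_of_subset (Finset.subset_univ _), hlc, Finset.card_univ]
  have hcast : ((Fintype.card V - k : ℕ) : ℝ) = Fintype.card V - k :=
    Nat.cast_sub (by omega)
  have h1 := pr_hasPath_le_pow (m := m) (k := s) hD (by rw [hcard]; omega) hgood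
  rw [hcard, hcast] at h1
  refine le_trans ?_ (h1.trans ?_)
  · refine le_trans (pr_mono fun l' _ h => ?_) (pr_take_le (b := r))
    unfold ChunkHasPath at h
    rwa [List.take_left' hl.length_eq, List.drop_left' hl.length_eq] at h
  · refine mul_le_mul_of_nonneg_right ?_ hq
    linarith [Nat.cast_nonneg (α := ℝ) k]

theorem pr_chunkHasPath_le (G : Digraph V) {k s m : ℕ} {D : ℝ} (hD : 1 ≤ D)
    (hks : k + s ≤ Fintype.card V) :
    pr (Fintype.card V) Finset.univ (ChunkHasPath G k s (m + 1)) ≤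
      Fintype.card V * Real.exp (-(D * k / Fintype.card V)) +
      Fintype.card V * ((D * s / (Fintype.card V - k)) ^ (m + 1) / (m + 1).factorial) := by
  refine (pr_chunkHasPath_aux G hD hks).trans (add_le_add_left ?_ _)
  calc _ ≤ pr k Finset.univ (fun l => ∃ v ∈ Finset.univ,
          v ∈ (l.foldl (seqStep G) (State.initial V)).alive ∧
          D ≤ (aliveInNeighbors G (l.foldl (seqStep G) (State.initial V))
            (Finset.univ \ l.toFinset) v).card) :=
        pr_mono fun l _ ⟨v, h1, h2⟩ => ⟨v, Finset.mem_univ v, h1, h2.le⟩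
    _ ≤ ∑ v : V, Real.exp (-(D / Fintype.card V)) ^ k :=
        (pr_exists _ _).trans (Finset.sum_le_sum fun v _ =>
          pr_many_aliveInNeighbors_le (zero_le_one.trans hD) Finset.card_univ.le v)
    _ = _ := by
        rw [Finset.sum_const, nsmul_eq_mul, Finset.card_univ, ← Real.exp_nat_mul]
        congr 2
        ring

theorem pr_chunkHasPath_zero_le (G : Digraph V) {s m d : ℕ} (hd : 1 ≤ d) (hG : InDegreeLE G d)
    (hs : s ≤ Fintype.card V) :
    pr (Fintype.card V) Finset.univ (ChunkHasPath G 0 s (m + 1)) ≤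
      Fintype.card V * (((d : ℝ) * s / Fintype.card V) ^ (m + 1) / (m + 1).factorial) := by
  have h := pr_chunkHasPath_aux G (k := 0) (s := s) (m := m) (D := d) (by exact_mod_cast hd)
    (by rwa [zero_add])
  refine h.trans ?_
  rw [pr_eq_zero, zero_add, Nat.cast_zero, sub_zero]
  · rintro l - ⟨v, -, hv⟩
    refine absurd hv (not_lt.2 ?_)
    refine le_trans ?_ (Nat.cast_le.2 (hG v))
    rw [Set.ncard_eq_toFinset_card']
    refine Nat.cast_le.2 (Finset.card_le_card fun u hu => ?_)
    simpa using (Finset.mem_filter.1 hu).2.2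

end Chunk

section Deterministic

variable {V : Type*} [Fintype V] {G : Digraph V} {π : Ordering V}

/-- `I` consists of exactly the vertices without an earlier in-neighbour in `I`. -/
def IsGreedySet (G : Digraph V) (π : Ordering V) (I : Set V) : Prop :=
  ∀ v, v ∈ I ↔ ∀ u ∈ I, G.Adj u v → ¬ π u < π v

theorem greedyState_succ (G : Digraph V) (π : Ordering V) (t : ℕ) :
    greedyState G π (t + 1) = greedyRound G π (greedyState G π t) :=
  Function.iterate_succ_apply' _ _ _

theorem greedyState_alive_antitone (G : Digraph V) (π : Ordering V) :
    Antitone fun t => (greedyState G π t).alive :=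
  antitone_nat_of_succ_le fun t => by
    rw [greedyState_succ]
    exact Set.sdiff_subset

theorem exists_earlier_of_mem_greedyState_succ {t : ℕ} {v : V}
    (h : v ∈ (greedyState G π (t + 1)).alive) :
    ∃ u ∈ (greedyState G π t).alive, G.Adj u v ∧ π u < π v := by
  rw [greedyState_succ] at h
  by_contra hu
  exact h.2 (Or.inl ⟨h.1, hu⟩)

theorem le_of_mem_greedyState {t : ℕ} {v : V} (h : v ∈ (greedyState G π t).alive) :
    t ≤ (π v : ℕ) := by
  induction t generalizing v with
  | zero => exact Nat.zero_le _
  | succ t ih =>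
    obtain ⟨u, hu, -, huv⟩ := exists_earlier_of_mem_greedyState_succ h
    exact (ih hu).trans_lt huv

theorem greedyState_card (G : Digraph V) (π : Ordering V) :
    (greedyState G π (Fintype.card V)).alive = ∅ :=
  Set.eq_empty_of_forall_notMem fun v hv => (le_of_mem_greedyState hv).not_gt (π v).2

/-- What holds after every round of the parallel algorithm. -/
structure GreedyInvariant (G : Digraph V) (π : Ordering V) (s : State V) : Prop where
  mem_chosen : ∀ v, v ∉ s.alive → (v ∈ s.chosen ↔ ∀ u ∈ s.chosen, G.Adj u v → ¬ π u < π v)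
  notMem_alive : ∀ u ∈ s.chosen, ∀ v, G.Adj u v → π u < π v → v ∉ s.alive
  disjoint : ∀ v ∈ s.chosen, v ∉ s.alive
  no_alive_earlier : ∀ v ∈ s.chosen, ∀ u ∈ s.alive, G.Adj u v → ¬ π u < π v

theorem GreedyInvariant.greedyRound {s : State V} (h : GreedyInvariant G π s) :
    GreedyInvariant G π (greedyRound G π s) where
  mem_chosen v hv := by
    by_cases hA : v ∈ s.alive
    · by_cases hJ : v ∈ sources G π s.alive
      · refine iff_of_true (Or.inr hJ) fun u hu huv hlt => ?_
        rcases hu with hu | hu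
        · exact h.notMem_alive u hu v huv hlt hA
        · exact hJ.2 ⟨u, hu.1, huv, hlt⟩
      · have hk : ∃ u ∈ sources G π s.alive, G.Adj u v ∧ π u < π v := by
          by_contra hk
          exact hv ⟨hA, fun h => h.elim hJ hk⟩
        obtain ⟨u, hu, huv, hlt⟩ := hk
        refine iff_of_false (fun hC => ?_) fun hC => hC u (Or.inr hu) huv hlt
        exact hC.elim (fun hC => h.disjoint v hC hA) hJ
    · have hJ : v ∉ sources G π s.alive := fun hJ => hA hJ.1
      constructor
      · intro hC u hu huv
        have hC := hC.resolve_right hJ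
        rcases hu with hu | hu
        · exact (h.mem_chosen v hA).1 hC u hu huv
        · exact h.no_alive_earlier v hC u hu.1 huv
      · exact fun hC => Or.inl ((h.mem_chosen v hA).2 fun u hu => hC u (Or.inl hu))
  notMem_alive u hu v huv hlt hv := by
    rcases hu with hu | hu
    · exact h.notMem_alive u hu v huv hlt hv.1
    · exact hv.2 (Or.inr ⟨u, hu, huv, hlt⟩)
  disjoint v hv hA := by
    rcases hv with hv | hv
    · exact h.disjoint v hv hA.1
    · exact hA.2 (Or.inl hv)
  no_alive_earlier v hv u hu huv hlt := by
    rcases hv with hv | hv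
    · exact h.no_alive_earlier v hv u hu.1 huv hlt
    · exact hv.2 ⟨u, hu.1, huv, hlt⟩

theorem greedyInvariant (G : Digraph V) (π : Ordering V) (t : ℕ) :
    GreedyInvariant G π (greedyState G π t) := by
  induction t with
  | zero => constructor <;> simp [greedyState, State.initial]
  | succ t ih =>
    rw [greedyState_succ]
    exact ih.greedyRound

theorem GreedyInvariant.isGreedySet {s : State V} (h : GreedyInvariant G π s)
    (hs : s.alive = ∅) : IsGreedySet G π s.chosen :=
  fun v => h.mem_chosen v (by simp [hs])

theorem GreedyInvariant.mem_chosen_iff {s : State V} (h : GreedyInvariant G π s) {I : Set V}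
    (hI : IsGreedySet G π I) {v : V} (hv : v ∉ s.alive) : v ∈ s.chosen ↔ v ∈ I := by
  induction hk : π v using WellFoundedLT.induction generalizing v with
  | ind k ih =>
    subst hk
    by_cases hC : v ∈ s.chosen
    · refine iff_of_true hC ((hI v).2 fun u hu huv hlt => ?_)
      have huA : u ∉ s.alive := fun huA => h.no_alive_earlier v hC u huA huv hlt
      exact (h.mem_chosen v hv).1 hC u ((ih _ hlt huA rfl).2 hu) huv hlt
    · have := (h.mem_chosen v hv).not.1 hC
      push Not at this
      obtain ⟨u, hu, huv, hlt⟩ := this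
      refine iff_of_false hC fun hvI => (hI v).1 hvI u ?_ huv hlt
      exact (ih _ hlt (h.disjoint u hu) rfl).1 hu

theorem foldl_take_eq {I : Set V} (hI : IsGreedySet G π I) {k : ℕ} (hk : k ≤ Fintype.card V) :
    ((List.ofFn π.symm).take k).foldl (seqStep G) (State.initial V) =
      ⟨{v | v ∈ I ∧ (π v : ℕ) < k}, {v | ∀ u ∈ I, (π u : ℕ) < k → ¬ G.Adj u v}⟩ := by
  induction k with
  | zero => ext <;> simp [State.initial]
  | succ k ih =>
    have hkl : k < (List.ofFn π.symm).length := by rw [List.length_ofFn]; exact hk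
    rw [List.take_succ_eq_append_getElem hkl, List.foldl_append, ih (Nat.le_of_succ_le hk),
      List.foldl_cons, List.foldl_nil, List.getElem_ofFn]
    set v := π.symm ⟨k, hk⟩ with hv
    have hπv : (π v : ℕ) = k := by simp [hv]
    have hlt (u : V) : (π u : ℕ) < k + 1 ↔ (π u : ℕ) < k ∨ u = v := by
      rw [Nat.lt_succ_iff_lt_or_eq, ← hπv, Fin.val_inj, π.apply_eq_iff_eq]
    have hmem : v ∈ {v | ∀ u ∈ I, (π u : ℕ) < k → ¬ G.Adj u v} ↔ v ∈ I := by
      rw [hI v, Set.mem_ofPred_eq]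
      refine forall₂_congr fun u _ => ?_
      rw [Fin.lt_def, hπv]
      tauto
    unfold seqStep
    split_ifs with hv'
    · have hvI : v ∈ I := hmem.1 hv'
      ext u
      · simp only [Set.mem_insert_iff, Set.mem_ofPred_eq, hlt]
        constructor
        · rintro (rfl | h)
          · exact ⟨hvI, Or.inr rfl⟩
          · exact ⟨h.1, Or.inl h.2⟩
        · rintro ⟨h, h' | h'⟩
          · exact Or.inr ⟨h, h'⟩
          · exact Or.inl h'
      · simp only [Set.mem_sdiff, Set.mem_ofPred_eq, hlt]
        constructor
        · rintro ⟨h1, h2⟩ w hw (h | rfl)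
          · exact h1 w hw h
          · exact h2
        · exact fun h => ⟨fun w hw hwk => h w hw (Or.inl hwk), h v hvI (Or.inr rfl)⟩
    · have hvI : v ∉ I := fun h => hv' (hmem.2 h)
      ext u
      · simp only [Set.mem_ofPred_eq, hlt]
        exact and_congr_right fun hu => ⟨Or.inl, fun h => h.resolve_right fun h => hvI (h ▸ hu)⟩
      · simp only [Set.mem_ofPred_eq, hlt]
        exact forall₂_congr fun w hw => ⟨fun h h' => h (h'.resolve_right fun h => hvI (h ▸ hw)),
          fun h h' => h (Or.inl h')⟩

theorem IsGreedySet.eq_lfmis {I : Set V} (hI : IsGreedySet G π I) : I = lfmis G π := by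
  have := foldl_take_eq hI le_rfl
  rw [List.take_of_length_le (by simp)] at this
  unfold lfmis
  rw [this]
  ext v
  simp

theorem mem_take_drop_ofFn {k s : ℕ} {v : V} (h1 : k ≤ π v) (h2 : (π v : ℕ) < k + s) :
    v ∈ ((List.ofFn π.symm).drop k).take s := by
  have := (π v).2
  rw [List.mem_iff_getElem]
  refine ⟨π v - k, by simp; omega, ?_⟩
  simp [Nat.add_sub_cancel' h1]

theorem exists_path_of_mem_greedyState {t j : ℕ} {v : V}
    (h : v ∈ (greedyState G π (t + j)).alive) :
    ∃ w : List V, w.length = j ∧ (w ++ [v]).IsChain G.Adj ∧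
      (w ++ [v]).Pairwise (fun a b => π a < π b) ∧
      ∀ x ∈ w ++ [v], x ∈ (greedyState G π t).alive ∧ π x ≤ π v := by
  induction j generalizing v with
  | zero => exact ⟨[], rfl, by simp, by simp, by simpa using h⟩
  | succ j ih =>
    have hv := greedyState_alive_antitone G π (Nat.le_add_right t (j + 1)) h
    obtain ⟨u, hu, huv, hlt⟩ := exists_earlier_of_mem_greedyState_succ h
    obtain ⟨w, hw, hc, hp, hx⟩ := ih hu
    refine ⟨w ++ [u], by simp [hw], ?_, ?_, ?_⟩
    · exact List.isChain_append.2 ⟨hc, by simp, by simpa using huv⟩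
    · refine List.pairwise_append.2 ⟨hp, by simp, fun a ha b hb => ?_⟩
      rw [List.mem_singleton.1 hb]
      exact (hx a ha).2.trans_lt hlt
    · intro x hxm
      rcases List.mem_append.1 hxm with hxm | hxm
      · exact ⟨(hx x hxm).1, (hx x hxm).2.trans hlt.le⟩
      · rw [List.mem_singleton.1 hxm]
        exact ⟨hv, le_rfl⟩

theorem le_of_not_chunkHasPath {k s m t : ℕ} (hk : k ≤ Fintype.card V)
    (ht : ∀ v ∈ (greedyState G π t).alive, k ≤ (π v : ℕ))
    (h : ¬ ChunkHasPath G k s (m + 1) (List.ofFn π.symm)) :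
    ∀ v ∈ (greedyState G π (t + (m + 1))).alive, k + s ≤ (π v : ℕ) := by
  intro v hv
  by_contra hvs
  push Not at hvs
  apply h
  have hI := (greedyInvariant G π _).isGreedySet (greedyState_card G π)
  obtain ⟨w, hw, hc, hp, hx⟩ := exists_path_of_mem_greedyState
    (greedyState_alive_antitone G π (Nat.le_succ (t + m)) hv)
  refine ⟨w ++ [v], by simp [hw], hc, fun x hxm => ?_, ?_⟩
  · rw [foldl_take_eq hI hk]
    intro u hu huk hux
    have huA : u ∉ (greedyState G π t).alive := fun huA => (ht u huA).not_gt huk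
    exact (greedyInvariant G π t).notMem_alive u
      (((greedyInvariant G π t).mem_chosen_iff hI huA).2 hu) x hux
      (Fin.lt_def.2 (huk.trans_le (ht x (hx x hxm).1))) (hx x hxm).1
  · have hl : (List.ofFn π.symm).Pairwise (fun a b => π a < π b) :=
      List.pairwise_ofFn.2 fun i j hij => by simpa using hij
    have : Std.Antisymm (fun a b : V => π a < π b) := ⟨fun a b h1 h2 => (lt_asymm h1 h2).elim⟩
    refine List.sublist_of_subperm_of_pairwise
      (List.subperm_of_subset (hp.imp fun h => ne_of_apply_ne π h.ne) fun x hxm => ?_) hp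
      (hl.sublist ((List.take_sublist _ _).trans (List.drop_sublist _ _)))
    obtain ⟨h1, h2⟩ := hx x hxm
    exact mem_take_drop_ofFn (ht x h1) ((Fin.le_def.1 h2).trans_lt hvs)

end Deterministic

section RoundBound

variable {V : Type*} [Fintype V]

theorem TerminatesWithin.mono {G : Digraph V} {π : Ordering V} {T T' : ℝ}
    (h : TerminatesWithin G π T) (hT : T ≤ T') : TerminatesWithin G π T' :=
  let ⟨t, ht, h⟩ := h
  ⟨t, ht.trans hT, h⟩

theorem orderProb_not_terminatesWithin_le (G : Digraph V) {s m₀ m K : ℕ} {T : ℝ}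
    (hK : Fintype.card V ≤ s * 2 ^ K) (hT : (m₀ + 1 + K * (m + 1) : ℝ) ≤ T)
    {b : ℕ → ℕ} (hb : ∀ i, b i = min (Fintype.card V) (s * 2 ^ i)) :
    orderProb V (fun π => ¬ TerminatesWithin G π T) ≤
      pr (Fintype.card V) Finset.univ (ChunkHasPath G 0 (b 0) (m₀ + 1)) +
      ∑ i ∈ Finset.range K, pr (Fintype.card V) Finset.univ
        (ChunkHasPath G (b i) (b (i + 1) - b i) (m + 1)) := by
  have hbn (i : ℕ) : b i ≤ Fintype.card V := (hb i).trans_le (min_le_left _ _)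
  have hmono (i : ℕ) : b i ≤ b (i + 1) := by
    rw [hb, hb, pow_succ]
    exact min_le_min_left _ (Nat.mul_le_mul_left s (by omega))
  calc _ ≤ orderProb V (fun π => ChunkHasPath G 0 (b 0) (m₀ + 1) (List.ofFn π.symm) ∨
          ∃ i ∈ Finset.range K,
            ChunkHasPath G (b i) (b (i + 1) - b i) (m + 1) (List.ofFn π.symm)) := by
        refine orderProb_mono fun π => not_imp_comm.1 fun hgood => ?_
        push Not at hgood
        obtain ⟨h0, h1⟩ := hgood
        have key : ∀ i ≤ K, ∀ v ∈ (greedyState G π (m₀ + 1 + i * (m + 1))).alive,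
            b i ≤ (π v : ℕ) := by
          intro i hi
          induction i with
          | zero =>
            have := le_of_not_chunkHasPath (t := 0) (Nat.zero_le _)
              (fun _ _ => Nat.zero_le _) h0
            simpa using this
          | succ i ih =>
            have := le_of_not_chunkHasPath (hbn i) (ih (Nat.le_of_succ_le hi))
              (h1 i (Finset.mem_range.2 hi))
            rwa [Nat.add_sub_cancel' (hmono i), add_assoc, ← Nat.succ_mul] at this
        refine ⟨m₀ + 1 + K * (m + 1), by exact_mod_cast hT,
          Set.eq_empty_of_forall_notMem fun v hv => ?_⟩
        have := key K le_rfl v hv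
        rw [hb, min_eq_left hK] at this
        exact this.not_gt (π v).2
    _ ≤ _ := orderProb_le_pr fun l => ChunkHasPath G 0 (b 0) (m₀ + 1) l ∨
          ∃ i ∈ Finset.range K, ChunkHasPath G (b i) (b (i + 1) - b i) (m + 1) l
    _ ≤ _ := (pr_or _ _ _ _).trans (by gcongr; exact pr_exists _ _)

theorem pow_div_factorial_le_exp_neg {y : ℝ} {m : ℕ} (hy : 0 ≤ y) {r : ℝ}
    (h : Real.exp (1 + r) * y ≤ m) : y ^ m / m.factorial ≤ Real.exp (-(r * m)) := by
  rcases m.eq_zero_or_pos with rfl | hm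
  · simp
  have hm' : (0 : ℝ) < m := by exact_mod_cast hm
  have h1 := Real.pow_div_factorial_le_exp (m : ℝ) hm'.le m
  have h2 : y / m ≤ Real.exp (-(1 + r)) := by
    rw [div_le_iff₀ hm', Real.exp_neg, ← div_eq_inv_mul, le_div_iff₀ (Real.exp_pos _)]
    linarith
  calc y ^ m / m.factorial = (y / m) ^ m * ((m : ℝ) ^ m / m.factorial) := by
        rw [div_pow]
        field_simp
    _ ≤ Real.exp (-(1 + r)) ^ m * Real.exp m := by gcongr
    _ = _ := by
        rw [← Real.exp_nat_mul, ← Real.exp_add]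
        congr 1
        ring

theorem half_lt_log {n : ℝ} (hn : 2 ≤ n) : 1 / 2 < Real.log n := by
  have := Real.log_two_gt_d9
  have := Real.log_le_log two_pos hn
  linarith

/-- The failure probability of a chunk that at most doubles the processed prefix. -/
theorem pr_doubling_chunk_le (G : Digraph V) {k k' m : ℕ} {a : ℝ} (ha : 2 ≤ a)
    (hn : 2 ≤ Fintype.card V) (hk : 1 ≤ k) (hkk : k ≤ k') (hk2 : k' ≤ 2 * k)
    (hkn : k' ≤ Fintype.card V)
    (hm : Real.exp 2 * (2 * a * Real.log (Fintype.card V)) ≤ (m + 1 : ℕ)) :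
    pr (Fintype.card V) Finset.univ (ChunkHasPath G k (k' - k) (m + 1)) ≤
      2 * (Fintype.card V * Real.exp (-(a * Real.log (Fintype.card V)))) := by
  set n := Fintype.card V with hnV
  have hn' : (2 : ℝ) ≤ n := by exact_mod_cast hn
  have hL := half_lt_log hn'
  set L := Real.log n
  have hk' : (1 : ℝ) ≤ k := by exact_mod_cast hk
  have hkn' : (k : ℝ) ≤ n := by exact_mod_cast hkk.trans hkn
  have hD : 1 ≤ a * n * L / k := by
    have haL : 1 ≤ a * L := by nlinarith
    rw [le_div_iff₀ (by linarith)]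
    calc 1 * (k : ℝ) ≤ a * L * n := by gcongr
      _ = a * n * L := by ring
  have hs : ((k' - k : ℕ) : ℝ) = k' - k := Nat.cast_sub hkk
  have hy : a * n * L / k * (k' - k : ℕ) / (n - k) ≤ 2 * a * L := by
    have h1 : (k' : ℝ) ≤ 2 * k := by exact_mod_cast hk2
    have h2 : (k' : ℝ) ≤ n := by exact_mod_cast hkn
    have h3 : (k : ℝ) ≤ k' := by exact_mod_cast hkk
    refine div_le_of_le_mul₀ (by linarith) (by positivity) ?_
    rw [div_mul_eq_mul_div, div_le_iff₀ (by linarith), hs]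
    have h4 : (n : ℝ) * (k' - k) ≤ 2 * (n - k) * k := by nlinarith
    calc a * n * L * (k' - k) = a * L * (n * (k' - k)) := by ring
      _ ≤ a * L * (2 * (n - k) * k) := by gcongr
      _ = _ := by ring
  have hy0 : 0 ≤ a * n * L / k * (k' - k : ℕ) / (n - k) := by
    have := sub_nonneg.2 hkn'
    positivity
  refine (pr_chunkHasPath_le G hD (by omega)).trans ?_
  rw [two_mul]
  refine add_le_add (le_of_eq ?_) (mul_le_mul_of_nonneg_left ?_ (Nat.cast_nonneg _))
  · congr 3
    rw [← hnV]
    field_simp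
  · refine (pow_div_factorial_le_exp_neg (r := 1) hy0 ?_).trans (Real.exp_le_exp.2 ?_)
    · rw [one_add_one_eq_two]
      exact le_trans (by gcongr) hm
    · have : 1 ≤ Real.exp 2 := Real.one_le_exp (by norm_num)
      have : 0 ≤ a * L := by positivity
      nlinarith

/-- The number of rounds, up to a constant factor, when all in-degrees are at most
`x * Real.log n`. -/
noncomputable def roundScale (x L : ℝ) : ℝ := Real.log (2 + x) / Real.log (2 + 1 / x) * L

theorem roundScale_mono {x x' L : ℝ} (hx : 0 < x) (hxx : x ≤ x') (hL : 0 ≤ L) :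
    roundScale x L ≤ roundScale x' L := by
  unfold roundScale
  have hx' : 0 < x' := hx.trans_le hxx
  have h1 : 0 < Real.log (2 + 1 / x') := Real.log_pos (by linarith [one_div_pos.2 hx'])
  have h2 : 0 ≤ Real.log (2 + x') := Real.log_nonneg (by linarith)
  gcongr

theorem orderProb_not_terminatesWithin_le_of_one_le (G : Digraph V) {d : ℕ} {a x : ℝ}
    (ha : 2 ≤ a) (hn : 2 ≤ Fintype.card V) (hd : 1 ≤ d) (hdn : d ≤ Fintype.card V)
    (hG : InDegreeLE G d) (hx : x = d / Real.log (Fintype.card V)) (hx1 : 1 ≤ x) {C : ℝ}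
    (hC : 8 * (2 * a * Real.exp 2 + 2) ≤ C) :
    orderProb V (fun π => ¬ TerminatesWithin G π
      (C * roundScale x (Real.log (Fintype.card V)))) ≤
        (Fintype.card V : ℝ) ^ 6 * Real.exp (-(a * Real.log (Fintype.card V))) := by
  set n := Fintype.card V with hnV
  have hn' : (2 : ℝ) ≤ n := by exact_mod_cast hn
  have hL := half_lt_log hn'
  set L := Real.log n with hLdef
  have hdn' : (d : ℝ) ≤ n := by exact_mod_cast hdn
  have hx2 : x ≤ 2 * n := by
    rw [hx, div_le_iff₀ (by linarith)]
    nlinarith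
  set s := ⌈(n : ℝ) / x⌉₊ with hs
  set K := ⌈Real.logb 2 x⌉₊ with hKdef
  set M := ⌈Real.exp 2 * (2 * a * L)⌉₊ with hM
  have hMpos : 0 < M := Nat.ceil_pos.2 (by positivity)
  obtain ⟨m, hm⟩ : ∃ m, M = m + 1 := ⟨M - 1, by omega⟩
  have hMle : Real.exp 2 * (2 * a * L) ≤ (m + 1 : ℕ) := hm ▸ Nat.le_ceil _
  have hMlt : ((m + 1 : ℕ) : ℝ) ≤ (2 * a * Real.exp 2 + 2) * L := by
    have := (Nat.ceil_lt_add_one (show 0 ≤ Real.exp 2 * (2 * a * L) by positivity)).le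
    rw [← hM, hm] at this
    linarith
  have hlog2 := half_lt_log le_rfl
  have hlogx : 0 ≤ Real.log x := Real.log_nonneg hx1
  have hKle : (K : ℝ) ≤ 2 * Real.log x + 1 := by
    have h1 : Real.logb 2 x ≤ 2 * Real.log x := by
      rw [Real.logb, div_le_iff₀ (by linarith)]
      nlinarith
    have := (Nat.ceil_lt_add_one (Real.logb_nonneg one_lt_two hx1)).le
    linarith
  have hxK : x ≤ 2 ^ K := by
    rw [← Real.rpow_natCast, ← Real.logb_le_iff_le_rpow one_lt_two (by linarith)]
    exact Nat.le_ceil _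
  have hsn : (n : ℝ) / x ≤ s := Nat.le_ceil _
  have hs1 : 1 ≤ s := Nat.ceil_pos.2 (by positivity)
  have hnK : n ≤ s * 2 ^ K := by
    have : (n : ℝ) ≤ s * 2 ^ K :=
      calc (n : ℝ) = n / x * x := by field_simp
        _ ≤ s * 2 ^ K := by gcongr
    exact_mod_cast this
  have hlog3 : 1 ≤ Real.log (2 + x) := by
    rw [Real.le_log_iff_exp_le (by linarith)]
    linarith [Real.exp_one_lt_d9]
  have hT : (m + 1 + K * (m + 1) : ℝ) ≤ C * roundScale x L := by
    have h1 : Real.log x ≤ Real.log (2 + x) := Real.log_le_log (by linarith) (by linarith)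
    have h2 : Real.log (2 + 1 / x) ≤ 2 := by
      have : 1 / x ≤ 1 := by rw [div_le_one (by linarith)]; exact hx1
      have := Real.log_le_sub_one_of_pos (show 0 < 2 + 1 / x by positivity)
      linarith
    have h3 : 0 < Real.log (2 + 1 / x) :=
      Real.log_pos (by linarith [one_div_pos.2 (zero_lt_one.trans_le hx1)])
    have h4 : Real.log (2 + x) / 2 * L ≤ roundScale x L := by
      unfold roundScale
      gcongr
    push_cast at hMlt
    calc (m + 1 + K * (m + 1) : ℝ) = (1 + K) * (m + 1) := by ring
      _ ≤ (4 * Real.log (2 + x)) * ((2 * a * Real.exp 2 + 2) * L) := by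
          gcongr
          linarith
      _ = (8 * (2 * a * Real.exp 2 + 2)) * (Real.log (2 + x) / 2 * L) := by ring
      _ ≤ C * roundScale x L := by
          refine mul_le_mul hC h4 (by positivity) (le_trans (by positivity) hC)
  have hprob := orderProb_not_terminatesWithin_le G (b := fun i => min n (s * 2 ^ i)) hnK hT
    (fun _ => rfl)
  refine hprob.trans ?_
  set E := (n : ℝ) * Real.exp (-(a * L)) with hE
  have hEpos : 0 ≤ E := by positivity
  have hb0 : min n (s * 2 ^ 0) ≤ n := min_le_left _ _
  have hfirst : pr n Finset.univ (ChunkHasPath G 0 (min n (s * 2 ^ 0)) (m + 1)) ≤ E := by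
    refine (pr_chunkHasPath_zero_le G hd hG hb0).trans
      (mul_le_mul_of_nonneg_left ?_ (Nat.cast_nonneg _))
    refine (pow_div_factorial_le_exp_neg (r := 1) (by positivity) ?_).trans
      (Real.exp_le_exp.2 ?_)
    · rw [one_add_one_eq_two]
      refine le_trans (mul_le_mul_of_nonneg_left ?_ (by positivity)) hMle
      rw [div_le_iff₀ (by linarith)]
      have h1 : ((min n (s * 2 ^ 0) : ℕ) : ℝ) ≤ n / x + 1 := by
        rw [pow_zero, mul_one]
        exact (Nat.cast_le.2 (min_le_right _ _)).trans
          (Nat.ceil_lt_add_one (by positivity)).le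
      have h2 : (d : ℝ) * (n / x) = L * n := by
        have : (d : ℝ) ≠ 0 := by positivity
        rw [hx]
        field_simp
      calc (d : ℝ) * (min n (s * 2 ^ 0) : ℕ) ≤ d * (n / x + 1) := by gcongr
        _ = L * n + d := by rw [mul_add, h2, mul_one]
        _ ≤ L * n + n := by gcongr
        _ = (L + 1) * n := by ring
        _ ≤ 2 * a * L * n := by
            gcongr
            nlinarith
    · have : 1 ≤ Real.exp 2 := Real.one_le_exp (by norm_num)
      have : 0 ≤ a * L := by positivity
      nlinarith
  have hrest : ∀ i ∈ Finset.range K, pr n Finset.univ (ChunkHasPath G (min n (s * 2 ^ i))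
      (min n (s * 2 ^ (i + 1)) - min n (s * 2 ^ i)) (m + 1)) ≤ 2 * E := by
    intro i _
    have h1 : 1 ≤ s * 2 ^ i := Nat.mul_pos hs1 (by positivity)
    have h2 : s * 2 ^ (i + 1) = 2 * (s * 2 ^ i) := by ring
    exact pr_doubling_chunk_le G ha hn (by omega) (by omega) (by omega) (min_le_left _ _) hMle
  refine (add_le_add hfirst (Finset.sum_le_sum hrest)).trans ?_
  rw [Finset.sum_const, Finset.card_range, nsmul_eq_mul]
  have hK4 : (K : ℝ) ≤ 4 * n := by
    have := Real.log_le_sub_one_of_pos (show 0 < x by linarith)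
    linarith
  calc E + K * (2 * E) = (1 + 2 * K) * E := by ring
    _ ≤ n ^ 5 * E := by
        gcongr
        have h1 : (2 : ℝ) ^ 4 ≤ n ^ 4 := by gcongr
        nlinarith
    _ = _ := by rw [hE]; ring

theorem orderProb_not_terminatesWithin_le_of_lt_one (G : Digraph V) {d : ℕ} {a x : ℝ}
    (ha : 2 ≤ a) (hn : 2 ≤ Fintype.card V) (hd : 1 ≤ d)
    (hG : InDegreeLE G d) (hx : x = d / Real.log (Fintype.card V)) (hx1 : x < 1) {C : ℝ}
    (hC : 2 * (2 * a + 21) ≤ C) :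
    orderProb V (fun π => ¬ TerminatesWithin G π
      (C * roundScale x (Real.log (Fintype.card V)))) ≤
        (Fintype.card V : ℝ) * Real.exp (-(a * Real.log (Fintype.card V))) := by
  set n := Fintype.card V with hnV
  have hn' : (2 : ℝ) ≤ n := by exact_mod_cast hn
  have hL := half_lt_log hn'
  set L := Real.log n with hLdef
  have hd' : (1 : ℝ) ≤ d := by exact_mod_cast hd
  have hxpos : 0 < x := by rw [hx]; positivity
  obtain ⟨z, hz⟩ : ∃ z, z = 1 / x := ⟨_, rfl⟩
  have hz1 : 1 < z := by rw [hz]; exact one_lt_one_div hxpos hx1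
  have hdz : (d : ℝ) * z = L := by
    rw [hz, hx]
    field_simp
  have hzL : z ≤ L := by nlinarith
  obtain ⟨ℓ, hℓ⟩ : ∃ ℓ, ℓ = Real.log (2 + z) := ⟨_, rfl⟩
  have hℓpos : 0 < ℓ := by rw [hℓ]; exact Real.log_pos (by linarith)
  have hℓ3 : ℓ ≤ 3 * L := by
    have := Real.log_le_sub_one_of_pos (show 0 < 2 + z by linarith)
    linarith
  set M := ⌈(2 * a + 18) * L / ℓ⌉₊ with hM
  have hMpos : 0 < M := Nat.ceil_pos.2 (by positivity)
  obtain ⟨m, hm⟩ : ∃ m, M = m + 1 := ⟨M - 1, by omega⟩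
  have hMle : (2 * a + 18) * L / ℓ ≤ (m + 1 : ℕ) := hm ▸ Nat.le_ceil _
  have hT : (m + 1 + (0 : ℕ) * (0 + 1) : ℝ) ≤ C * roundScale x L := by
    have h1 := (Nat.ceil_lt_add_one (show 0 ≤ (2 * a + 18) * L / ℓ by positivity)).le
    rw [← hM, hm] at h1
    push_cast at h1 ⊢
    have h2 : 1 ≤ 3 * L / ℓ := (one_le_div hℓpos).2 hℓ3
    have h3 : 1 / 2 ≤ Real.log (2 + x) := (half_lt_log (by linarith)).le
    calc (m + 1 + 0 * (0 + 1) : ℝ) ≤ (2 * a + 18) * L / ℓ + 3 * L / ℓ := by linarith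
      _ = 2 * (2 * a + 21) * (1 / 2 / ℓ * L) := by ring
      _ ≤ C * (Real.log (2 + x) / ℓ * L) := by
          refine mul_le_mul hC ?_ (by positivity) (le_trans (by positivity) hC)
          gcongr
      _ = C * roundScale x L := by rw [roundScale, hℓ, hz]
  have hprob := orderProb_not_terminatesWithin_le G (s := n) (m₀ := m) (m := 0) (K := 0)
    (b := fun i => min n (n * 2 ^ i)) (Nat.le_mul_of_pos_right _ (by simp)) (by exact_mod_cast hT) (fun _ => rfl)
  refine hprob.trans ?_
  rw [Finset.sum_range_zero, add_zero, pow_zero, mul_one, min_self]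
  refine (pr_chunkHasPath_zero_le G hd hG le_rfl).trans
    (mul_le_mul_of_nonneg_left ?_ (Nat.cast_nonneg _))
  rw [← hnV, mul_div_cancel_right₀ _ (by positivity)]
  refine (pow_div_factorial_le_exp_neg (r := ℓ / 2) (by positivity) ?_).trans
    (Real.exp_le_exp.2 ?_)
  · refine le_trans ?_ hMle
    rw [le_div_iff₀ hℓpos]
    have hsq : Real.exp (ℓ / 2) ^ 2 = 2 + z := by
      rw [← Real.exp_nat_mul, hℓ]
      push_cast
      rw [mul_div_cancel₀ _ two_ne_zero, Real.exp_log (by linarith)]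
    have hle : ℓ / 2 ≤ Real.exp (ℓ / 2) := by linarith [Real.add_one_le_exp (ℓ / 2)]
    have h1 : Real.exp (ℓ / 2) * ℓ ≤ 6 * z := by nlinarith [Real.exp_pos (ℓ / 2)]
    have h3 : Real.exp 1 ≤ 3 := by linarith [Real.exp_one_lt_d9]
    rw [Real.exp_add]
    calc Real.exp 1 * Real.exp (ℓ / 2) * d * ℓ = Real.exp 1 * d * (Real.exp (ℓ / 2) * ℓ) := by
          ring
      _ ≤ 3 * d * (6 * z) := by gcongr
      _ = 18 * L := by rw [← hdz]; ring
      _ ≤ (2 * a + 18) * L := by gcongr; linarith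
  · have := (div_le_iff₀ hℓpos).1 hMle
    nlinarith

/-- The high-probability round bound for bounded in-degree. -/
theorem exists_roundScale_bound (c : ℝ) (hc : 0 < c) : ∃ C : ℝ, 0 < C ∧
    ∀ (V : Type*) [Fintype V] (G : Digraph V), 2 ≤ Fintype.card V →
      ∀ d : ℕ, 1 ≤ d → InDegreeLE G d →
        1 - (Fintype.card V : ℝ) ^ (-c) ≤ orderProb V fun π => TerminatesWithin G π
          (C * roundScale (d / Real.log (Fintype.card V)) (Real.log (Fintype.card V))) := by
  have ha : 2 ≤ c + 6 := by linarith
  refine ⟨8 * (2 * (c + 6) * Real.exp 2 + 2) + 2 * (2 * (c + 6) + 21), by positivity, ?_⟩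
  intro V _ G hn d hd hG
  have hn' : (2 : ℝ) ≤ Fintype.card V := by exact_mod_cast hn
  have hL := half_lt_log hn'
  have hG' : InDegreeLE G (min d (Fintype.card V)) := fun v =>
    le_min (hG v) ((Set.ncard_le_card _).trans_eq Nat.card_eq_fintype_card)
  have hd' : 1 ≤ min d (Fintype.card V) := le_min hd (by omega)
  have hpow : (Fintype.card V : ℝ) ^ 6 * Real.exp (-((c + 6) * Real.log (Fintype.card V))) =
      (Fintype.card V : ℝ) ^ (-c) := by
    rw [Real.rpow_def_of_pos (by linarith), ← Real.exp_log (show (0 : ℝ) < Fintype.card V by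
      linarith), ← Real.exp_nat_mul, Real.log_exp, ← Real.exp_add]
    congr 1
    push_cast
    ring
  have hmain : orderProb V (fun π => ¬ TerminatesWithin G π
      ((8 * (2 * (c + 6) * Real.exp 2 + 2) + 2 * (2 * (c + 6) + 21)) *
        roundScale ((min d (Fintype.card V) : ℕ) / Real.log (Fintype.card V))
          (Real.log (Fintype.card V)))) ≤ (Fintype.card V : ℝ) ^ (-c) := by
    rw [← hpow]
    rcases le_or_gt 1 (((min d (Fintype.card V) : ℕ) : ℝ) / Real.log (Fintype.card V)) with h | h
    · exact orderProb_not_terminatesWithin_le_of_one_le G ha hn hd' (min_le_right _ _) hG' rfl h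
        (le_add_of_nonneg_right (by positivity))
    · refine (orderProb_not_terminatesWithin_le_of_lt_one G ha hn hd' hG' rfl h
        (le_add_of_nonneg_left (by positivity))).trans ?_
      gcongr
      exact le_self_pow₀ (by linarith) (by norm_num)
  rw [orderProb_not]
  refine sub_le_sub_left (le_trans (orderProb_mono fun π h h' => h (h'.mono ?_)) hmain) 1
  refine mul_le_mul_of_nonneg_left (roundScale_mono ?_ ?_ (by linarith)) (by positivity)
  · have : (0 : ℝ) < (min d (Fintype.card V) : ℕ) := by exact_mod_cast hd'
    positivity
  · gcongr
    exact min_le_left _ _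

end RoundBound

theorem roundScale_le {n d : ℕ} (hn : 2 ≤ n) (hd : 1 ≤ d) :
    roundScale (d / Real.log n) (Real.log n) ≤ 4 * (Real.log (d + 1) * Real.log n) := by
  have hL := half_lt_log (n := n) (by exact_mod_cast hn)
  have hd' : (1 : ℝ) ≤ d := by exact_mod_cast hd
  have hx : (d : ℝ) / Real.log n ≤ 2 * d := by
    rw [div_le_iff₀ (by linarith)]
    nlinarith
  have hx0 : 0 < (d : ℝ) / Real.log n := by positivity
  have h1 : Real.log (2 + d / Real.log n) ≤ 2 * Real.log (d + 1) :=
    calc _ ≤ Real.log (2 * (d + 1)) := Real.log_le_log (by positivity) (by linarith)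
      _ = Real.log 2 + Real.log (d + 1) := Real.log_mul (by norm_num) (by positivity)
      _ ≤ _ := by linarith [Real.log_le_log two_pos (show (2 : ℝ) ≤ d + 1 by linarith)]
  have h2 := half_lt_log (show 2 ≤ 2 + 1 / (d / Real.log n) by linarith [one_div_pos.2 hx0])
  have h3 : 0 ≤ Real.log ((d : ℝ) + 1) := Real.log_nonneg (by linarith)
  unfold roundScale
  calc _ ≤ 2 * Real.log (d + 1) / (1 / 2) * Real.log n := by gcongr
    _ = _ := by ring

end DirectedLFMIS

theorem mainTheorem3 :
    (∀ (V : Type*) [Fintype V] (G : Digraph V) (π : DirectedLFMIS.Ordering V),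
      ∃ T : ℕ, (DirectedLFMIS.greedyState G π T).alive = ∅ ∧
        (DirectedLFMIS.greedyState G π T).chosen = DirectedLFMIS.lfmis G π) ∧
    ∀ c : ℝ, 0 < c → ∃ C : ℝ, 0 < C ∧
      ∀ (V : Type*) [Fintype V] (G : Digraph V) (n : ℕ), n = Fintype.card V → 2 ≤ n →
        (1 - (n : ℝ) ^ (-c) ≤ DirectedLFMIS.orderProb V fun π =>
          DirectedLFMIS.TerminatesWithin G π (C * Real.log n ^ 2)) ∧
        ∀ (d : ℕ) (x : ℝ), 1 ≤ d → DirectedLFMIS.InDegreeLE G d → x = d / Real.log n →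
          (1 - (n : ℝ) ^ (-c) ≤ DirectedLFMIS.orderProb V fun π =>
            DirectedLFMIS.TerminatesWithin G π
              (C * (Real.log (2 + x) / Real.log (2 + 1 / x) * Real.log n))) ∧
          (1 - (n : ℝ) ^ (-c) ≤ DirectedLFMIS.orderProb V fun π =>
            DirectedLFMIS.TerminatesWithin G π
              (C * (Real.log (d + 1) * Real.log n))) := by
  refine ⟨fun V _ G π => ⟨Fintype.card V, DirectedLFMIS.greedyState_card G π, ?_⟩,
    fun c hc => ?_⟩
  · exact ((DirectedLFMIS.greedyInvariant G π _).isGreedySet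
      (DirectedLFMIS.greedyState_card G π)).eq_lfmis
  obtain ⟨C, hC, h⟩ := DirectedLFMIS.exists_roundScale_bound c hc
  refine ⟨8 * C, by positivity, ?_⟩
  rintro V _ G n rfl hn
  have hn' : (2 : ℝ) ≤ Fintype.card V := by exact_mod_cast hn
  have hL := DirectedLFMIS.half_lt_log hn'
  refine ⟨?_, fun d x hd hG hx => ⟨?_, ?_⟩⟩
  · refine (h V G hn (Fintype.card V) (by omega) fun v =>
      (Set.ncard_le_card _).trans_eq Nat.card_eq_fintype_card).trans
        (DirectedLFMIS.orderProb_mono fun π hπ => hπ.mono ?_)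
    have h1 := DirectedLFMIS.roundScale_le hn (d := Fintype.card V) (by omega)
    have h2 : Real.log (Fintype.card V + 1) ≤ 2 * Real.log (Fintype.card V) := by
      rw [← Real.log_rpow (by linarith)]
      refine Real.log_le_log (by linarith) ?_
      norm_num
      nlinarith
    calc _ ≤ C * (4 * (2 * Real.log (Fintype.card V) * Real.log (Fintype.card V))) := by
          refine mul_le_mul_of_nonneg_left (h1.trans ?_) hC.le
          gcongr
      _ = _ := by ring
  · refine (h V G hn d hd hG).trans (DirectedLFMIS.orderProb_mono fun π hπ => hπ.mono ?_)
    rw [← hx]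
    have hxpos : 0 < x := by rw [hx]; positivity
    refine mul_le_mul_of_nonneg_right (by linarith) (mul_nonneg (div_nonneg ?_ ?_) (by linarith))
    · exact Real.log_nonneg (by linarith)
    · exact Real.log_nonneg (by linarith [one_div_pos.2 hxpos])
  · refine (h V G hn d hd hG).trans (DirectedLFMIS.orderProb_mono fun π hπ => hπ.mono ?_)
    have h1 := DirectedLFMIS.roundScale_le hn hd
    have h2 : 0 ≤ Real.log ((d : ℝ) + 1) :=
      Real.log_nonneg (by linarith [Nat.cast_nonneg (α := ℝ) d])
    have h3 : 0 ≤ Real.log ((d : ℝ) + 1) * Real.log (Fintype.card V) := mul_nonneg h2 (by linarith)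
    calc _ ≤ C * (4 * (Real.log (d + 1) * Real.log (Fintype.card V))) :=
          mul_le_mul_of_nonneg_left h1 hC.le
      _ ≤ _ := by nlinarith
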